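/- Let $\Omega$ be a $\sigma$-compact topological space with a positive regular Borel measure $\mu$, let $K:\Omega\to\mathbb{C}$ be locally integrable, and let $(A(u))_{u\in\Omega}$ be a $\mu$-measurable, pairwise commuting family of real self-adjoint $n\times n$ matrices that are non-singular for $\mu$-almost every $u$ with $K(u)\neq 0$. Assume that $|\det A(u)|^{-1/2}K(u)\in L^1(\Omega,\mu)$. Then $$(\mathcal{H}_{K,A}f)(x)=\int_\Omega K(u)\,f(A(u)x)\,d\mu(u)$$ (where the integral converges absolutely for a.e. $x$) defines a bounded operator $\mathcal{H}_{K,A}$ on the complex Hilbert space $L^2(\mathbb{R}^n)$, and there are an orthogonal matrix $C$ and a real vector function $a(u)=(a_1(u),\dots,a_n(u))$ with $C^{-1}A(u)C=\mathrm{diag}(a_1(u),\dots,a_n(u))$ for all $u\in\Omega$. For any such $C$ and $a$, and any enumeration $U_1,\dots,U_{2^n}$ of the open hyperoctants of $\mathbb{R}^n$, let $\varepsilon(i,j)\in\{-1,1\}^n$ be the unique sign vector whose coordinatewise action maps $U_i$ onto $U_j$, let $\Omega_{ij}=\{u\in\Omega:(\operatorname{sgn}a_1(u),\dots,\operatorname{sgn}a_n(u))=\varepsilon(i,j)\}$,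 and define the matrix symbol $\Phi(s)=(\varphi_{ij}(s))_{i,j=1}^{2^n}$ for $s\in\mathbb{R}^n$ by $$\varphi_{ij}(s)=\int_{\Omega_{ij}}K(u)\prod_{k=1}^n|a_k(u)|^{-1/2-\mathrm{i}s_k}\,d\mu(u).$$ Then: (a) $\mathcal{H}_{K,A}$ is self-adjoint if and only if $\Phi(s)$ is self-adjoint for every $s\in\mathbb{R}^n$; (b) $\mathcal{H}_{K,A}$ is positive, i.e. $\langle\mathcal{H}_{K,A}f,f\rangle\ge 0$ for all $f\in L^2(\mathbb{R}^n)$, if and only if $\Phi(s)$ is positive definite in the same non-strict sense, i.e. $\langle\Phi(s)v,v\rangle\ge 0$ for all $v\in\mathbb{C}^{2^n}$, for every $s\in\mathbb{R}^n$; (c) $\mathcal{H}_{K,A}$ is unitary if and only if $\Phi(s)$ is unitary for every $s\in\mathbb{R}^n$. -/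

import Mathlib

open MeasureTheory
open scoped ComplexOrder

/-- The complex Hilbert space `L²(ℝⁿ)` with respect to Lebesgue measure.  Only the measure on `ℝⁿ`
enters, so `ℝⁿ` is taken as the space of coordinate functions. -/
abbrev L2Space (n : ℕ) : Type := Lp ℂ 2 (volume : Measure (Fin n → ℝ))

/-- `H` is the Hausdorff operator `(H f)(x) = ∫_Ω K(u) f(A(u) x) dμ(u)` on `L²(ℝⁿ)`: for every
square-integrable function `f` the integral converges absolutely for almost every `x` and its value
is `(H f)(x)`. -/
def IsHausdorffOperator {Ω : Type*} [MeasurableSpace Ω] {n : ℕ} (μ : Measure Ω)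
    (K : Ω → ℂ) (A : Ω → Matrix (Fin n) (Fin n) ℝ) (H : L2Space n →L[ℂ] L2Space n) : Prop :=
  ∀ (f : (Fin n → ℝ) → ℂ) (hf : MemLp f 2 volume),
    ∀ᵐ x : Fin n → ℝ,
      Integrable (fun u => K u * f ((A u).mulVec x)) μ ∧
      H (hf.toLp f) x = ∫ u, K u * f ((A u).mulVec x) ∂μ

/-- The defining property determines the operator. -/
theorem IsHausdorffOperator.unique {Ω : Type*} [MeasurableSpace Ω] {n : ℕ} {μ : Measure Ω}
    {K : Ω → ℂ} {A : Ω → Matrix (Fin n) (Fin n) ℝ} {H₁ H₂ : L2Space n →L[ℂ] L2Space n}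
    (h₁ : IsHausdorffOperator μ K A H₁) (h₂ : IsHausdorffOperator μ K A H₂) : H₁ = H₂ := by
  ext1 f
  have hf : MemLp (f : (Fin n → ℝ) → ℂ) 2 volume := Lp.memLp f
  have key : H₁ (hf.toLp f) = H₂ (hf.toLp f) := by
    apply Lp.ext
    filter_upwards [h₁ f hf, h₂ f hf] with x hx₁ hx₂
    rw [hx₁.2, hx₂.2]
  simpa using key

/-- `C` is an orthogonal matrix with `C⁻¹ A(u) C = diag (a₁(u), …, aₙ(u))` for all `u`. -/
structure IsSimultaneousDiagonalization {Ω : Type*} {n : ℕ}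
    (A : Ω → Matrix (Fin n) (Fin n) ℝ) (C : Matrix (Fin n) (Fin n) ℝ)
    (a : Ω → Fin n → ℝ) : Prop where
  orthogonal : C ∈ Matrix.orthogonalGroup (Fin n) ℝ
  diag : ∀ u, C⁻¹ * A u * C = Matrix.diagonal (a u)

/-- The open hyperoctant of `ℝⁿ` with sign pattern `σ ∈ {-1, 1}ⁿ`. -/
def hyperoctant {n : ℕ} (σ : Fin n → ℤˣ) : Set (Fin n → ℝ) :=
  {x | ∀ k, 0 < ((σ k : ℤ) : ℝ) * x k}

/-- An enumeration `U₁, …, U_{2ⁿ}` of the open hyperoctants is given by an enumeration `e` of the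
sign patterns, `Uᵢ = hyperoctant (e i)`.  This is the sign pattern `ε(i, j)` which carries `Uᵢ`
onto `Uⱼ`. -/
def octantSign {n : ℕ} (e : Fin (2 ^ n) ≃ (Fin n → ℤˣ)) (i j : Fin (2 ^ n)) : Fin n → ℤˣ :=
  fun k => e i k * e j k

/-- `ε(i, j) Uᵢ = Uⱼ`, and `ε(i, j)` is the only sign pattern with this property. -/
theorem image_hyperoctant_eq_iff {n : ℕ} (e : Fin (2 ^ n) ≃ (Fin n → ℤˣ)) (i j : Fin (2 ^ n))
    (ε : Fin n → ℤˣ) :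
    (fun (x : Fin n → ℝ) k => ((ε k : ℤ) : ℝ) * x k) '' hyperoctant (e i) = hyperoctant (e j) ↔
      ε = octantSign e i j := by
  have sq : ∀ σ : ℤˣ, ((σ : ℤ) : ℝ) * ((σ : ℤ) : ℝ) = 1 := by
    intro σ
    rcases Int.units_eq_one_or σ with rfl | rfl <;> norm_num
  constructor
  · intro h
    have hx : (fun k => (((e i k : ℤˣ) : ℤ) : ℝ)) ∈ hyperoctant (e i) := by
      intro k
      simp [sq]
    have hy := h ▸ Set.mem_image_of_mem (fun (x : Fin n → ℝ) k => ((ε k : ℤ) : ℝ) * x k) hx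
    funext k
    have hk := hy k
    simp only [octantSign]
    rcases Int.units_eq_one_or (e i k) with h1 | h1 <;>
      rcases Int.units_eq_one_or (e j k) with h2 | h2 <;>
      rcases Int.units_eq_one_or (ε k) with h3 | h3 <;>
      simp only [h1, h2, h3] at hk ⊢ <;> first | rfl | norm_num at hk
  · rintro rfl
    ext y
    simp only [hyperoctant, octantSign, Set.mem_image, Set.mem_ofPred_eq]
    constructor
    · rintro ⟨x, hx, rfl⟩ k
      have := hx k
      push_cast
      have h2 := sq (e j k)
      calc (0 : ℝ) < (((e i k : ℤˣ) : ℤ) : ℝ) * x k := this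
        _ = _ := by linear_combination (-(((e i k : ℤˣ) : ℤ) : ℝ) * x k) * h2
    · intro hy
      refine ⟨fun k => (((e i k : ℤˣ) : ℤ) : ℝ) * (((e j k : ℤˣ) : ℤ) : ℝ) * y k, ?_, ?_⟩
      · intro k
        have h1 := sq (e i k)
        have := hy k
        calc (0 : ℝ) < (((e j k : ℤˣ) : ℤ) : ℝ) * y k := this
          _ = _ := by linear_combination (-(((e j k : ℤˣ) : ℤ) : ℝ) * y k) * h1
      · funext k
        have h1 := sq (e i k)
        have h2 := sq (e j k)
        push_cast
        linear_combination ((((e j k : ℤˣ) : ℤ) : ℝ) ^ 2 * y k) * h1 + y k * h2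

/-- `Ω_{ij}`, the set of those `u` for which the signs of `a₁(u), …, aₙ(u)` are `ε(i, j)`. -/
def signSet {Ω : Type*} {n : ℕ} (a : Ω → Fin n → ℝ) (e : Fin (2 ^ n) ≃ (Fin n → ℤˣ))
    (i j : Fin (2 ^ n)) : Set Ω :=
  {u | ∀ k, Real.sign (a u k) = ((octantSign e i j k : ℤ) : ℝ)}

/-- `|b|^{-1/2 - 𝚤 s} = ∏ₖ exp ((-1/2 - 𝚤 sₖ) log |bₖ|)` for `b, s ∈ ℝⁿ` (used for nonzero `bₖ`). -/
noncomputable def absCpow {n : ℕ} (b s : Fin n → ℝ) : ℂ :=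
  ∏ k, Complex.exp ((-(1 / 2) - Complex.I * (s k : ℂ)) * (Real.log |b k| : ℂ))

/-- The matrix symbol `Φ(s) = (φ_{ij}(s))`, `φ_{ij}(s) = ∫_{Ω_{ij}} K(u) |a(u)|^{-1/2 - 𝚤 s} dμ(u)`,
for the eigenvalue functions `a` and the enumeration `e` of the hyperoctants. -/
noncomputable def matrixSymbol {Ω : Type*} [MeasurableSpace Ω] {n : ℕ} (μ : Measure Ω)
    (K : Ω → ℂ) (a : Ω → Fin n → ℝ) (e : Fin (2 ^ n) ≃ (Fin n → ℤˣ)) (s : Fin n → ℝ) :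
    Matrix (Fin (2 ^ n)) (Fin (2 ^ n)) ℂ :=
  Matrix.of fun i j => ∫ u in signSet a e i j, K u * absCpow (a u) s ∂μ

/-! Logarithmic coordinates turn the commuting matrices `A u` into translations, and the Fourier
transform turns an average of translations into a multiplication.

A commuting family of symmetric matrices has a common orthonormal eigenbasis, the columns of `C`.
Parametrize the rotated hyperoctant `C Uᵢ` by `x = C (σ e^y)`. For `u ∈ Ω_{ij}`, `A u` maps `C Uᵢ`
onto `C Uⱼ` and acts as `y ↦ y + log |a u|` (`mulVec_octantMap`). With the weight `e^{∑ y / 2}` the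
parametrizations identify `L²(ℝⁿ)` with `2ⁿ` copies of itself (`octantIsometry`). The weight
contributes the factor `|det A u|^{-1/2}` (`kernel_octantMap`), so by the integrability hypothesis
each entry of the resulting operator matrix averages translations against a finite complex measure.
Such an average is the Fourier multiplier given by the inverse Fourier transform of that measure, a
bounded continuous function (`fourierMultiplier_fourierSymbol_ae_eq`).

Hence `H` is unitarily equivalent to multiplication by `ξ ↦ Φ(-2πξ)`. Boundedness comes for free:
the operator is defined by this conjugation and then shown to be given by the integral.
Multiplication by matrices is an injective unital *-homomorphism, so self-adjointness and unitarity
are pointwise identities; positivity is tested on indicators. Continuity of `Φ` and full support of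
Lebesgue measure give every `s`, not only almost every one. -/

open scoped BoundedContinuousFunction InnerProductSpace ENNReal FourierTransform SchwartzMap

/-! ### Multiplication by matrices of bounded continuous functions on vector-valued `L²`. -/

section MultiplicationOperators

variable {X : Type*} [TopologicalSpace X] [MeasurableSpace X] [BorelSpace X] {ν : Measure X}

/-- Multiplication by a bounded continuous function, as an operator on `L²`. -/
noncomputable def mulLp (ν : Measure X) (φ : X →ᵇ ℂ) : Lp ℂ 2 ν →L[ℂ] Lp ℂ 2 ν :=
  (ContinuousLinearMap.mul ℂ ℂ).holderL ν ∞ 2 2 ((φ.memLp_top (μ := ν)).toLp φ)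

theorem coeFn_mulLp (φ : X →ᵇ ℂ) (f : Lp ℂ 2 ν) : mulLp ν φ f =ᵐ[ν] fun x => φ x * f x := by
  have h := (ContinuousLinearMap.mul ℂ ℂ).coeFn_holder (r := 2)
    ((φ.memLp_top (μ := ν)).toLp φ) f
  filter_upwards [h, (φ.memLp_top (μ := ν)).coeFn_toLp] with x h1 h2
  change (ContinuousLinearMap.holder 2 (ContinuousLinearMap.mul ℂ ℂ)
    ((φ.memLp_top (μ := ν)).toLp φ) f) x = _
  rw [h1, h2]
  rfl

theorem mulLp_mul (φ ψ : X →ᵇ ℂ) (f : Lp ℂ 2 ν) :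
    mulLp ν (φ * ψ) f = mulLp ν φ (mulLp ν ψ f) := by
  apply Lp.ext
  filter_upwards [coeFn_mulLp (φ * ψ) f, coeFn_mulLp φ (mulLp ν ψ f), coeFn_mulLp ψ f]
    with x h1 h2 h3
  rw [h1, h2, h3, BoundedContinuousFunction.mul_apply, mul_assoc]

theorem mulLp_add (φ ψ : X →ᵇ ℂ) (f : Lp ℂ 2 ν) :
    mulLp ν (φ + ψ) f = mulLp ν φ f + mulLp ν ψ f := by
  apply Lp.ext
  filter_upwards [coeFn_mulLp (φ + ψ) f, coeFn_mulLp φ f, coeFn_mulLp ψ f,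
    Lp.coeFn_add (mulLp ν φ f) (mulLp ν ψ f)] with x h1 h2 h3 h4
  rw [h1, h4, Pi.add_apply, h2, h3, BoundedContinuousFunction.add_apply, add_mul]

theorem mulLp_zero (f : Lp ℂ 2 ν) : mulLp ν (0 : X →ᵇ ℂ) f = 0 := by
  apply Lp.ext
  filter_upwards [coeFn_mulLp (0 : X →ᵇ ℂ) f, Lp.coeFn_zero ℂ 2 ν] with x h1 h2
  rw [h1, h2]
  simp

theorem mulLp_one (f : Lp ℂ 2 ν) : mulLp ν (1 : X →ᵇ ℂ) f = f := by
  apply Lp.ext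
  filter_upwards [coeFn_mulLp (1 : X →ᵇ ℂ) f] with x h1
  rw [h1]
  simp

theorem mulLp_sum {ι : Type*} (s : Finset ι) (φ : ι → X →ᵇ ℂ) (f : Lp ℂ 2 ν) :
    mulLp ν (∑ i ∈ s, φ i) f = ∑ i ∈ s, mulLp ν (φ i) f := by
  classical
  induction s using Finset.induction_on with
  | empty => simp [mulLp_zero]
  | insert a s ha ih => rw [Finset.sum_insert ha, Finset.sum_insert ha, mulLp_add, ih]

theorem inner_mulLp (φ : X →ᵇ ℂ) (f g : Lp ℂ 2 ν) :
    ⟪g, mulLp ν φ f⟫_ℂ = ∫ x, φ x * ⟪g x, f x⟫_ℂ ∂ν := by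
  rw [L2.inner_def]
  refine integral_congr_ae ?_
  filter_upwards [coeFn_mulLp φ f] with x h1
  rw [h1]
  simp only [RCLike.inner_apply]
  ring

theorem mulLp_star_inner (φ : X →ᵇ ℂ) (f g : Lp ℂ 2 ν) :
    ⟪mulLp ν (star φ) f, g⟫_ℂ = ⟪f, mulLp ν φ g⟫_ℂ := by
  rw [L2.inner_def, inner_mulLp]
  refine integral_congr_ae ?_
  filter_upwards [coeFn_mulLp (star φ) f] with x h1
  rw [h1]
  simp only [RCLike.inner_apply, BoundedContinuousFunction.star_apply, map_mul,
    RCLike.star_def, RingHomCompTriple.comp_apply, RingHom.id_apply]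
  ring

/-- Continuous functions that agree almost everywhere for a measure of full support are equal. The
constant `1` need not lie in `L²`, so the operators are compared on indicators of finite-measure
sets exhausting the space. -/
theorem mulLp_injective [T2Space X] [SigmaFinite ν] [ν.IsOpenPosMeasure] :
    Function.Injective (mulLp ν) := by
  intro φ ψ h
  apply DFunLike.coe_injective
  refine (φ.continuous.ae_eq_iff_eq ν ψ.continuous).1 ?_
  have key : ∀ k, ∀ᵐ x ∂ν, x ∈ spanningSets ν k → φ x = ψ x := by
    intro k
    have hm := measurableSet_spanningSets ν k
    have hk : ν (spanningSets ν k) ≠ ∞ := (measure_spanningSets_lt_top ν k).ne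
    have h1 := coeFn_mulLp φ (indicatorConstLp 2 hm hk (1 : ℂ))
    rw [h] at h1
    filter_upwards [h1, coeFn_mulLp ψ (indicatorConstLp 2 hm hk (1 : ℂ)),
      indicatorConstLp_coeFn (p := 2) (hs := hm) (hμs := hk) (c := (1 : ℂ))] with x h1 h2 h3 hx
    rw [h2, h3, Set.indicator_of_mem hx] at h1
    simpa using h1.symm
  filter_upwards [ae_all_iff.2 key] with x hx
  obtain ⟨k, hk⟩ := Set.mem_iUnion.1 ((iUnion_spanningSets ν).symm ▸ Set.mem_univ x)
  exact hx k hk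

variable {ι : Type*} [Fintype ι]

/-- Multiplication by a matrix of bounded continuous functions, as an operator on the Hilbert
space of vectors of `L²` functions. -/
noncomputable def matMulLp (ν : Measure X) (Φ : Matrix ι ι (X →ᵇ ℂ)) :
    PiLp 2 (fun _ : ι => Lp ℂ 2 ν) →L[ℂ] PiLp 2 (fun _ : ι => Lp ℂ 2 ν) :=
  (PiLp.continuousLinearEquiv 2 ℂ (fun _ : ι => Lp ℂ 2 ν)).symm.toContinuousLinearMap ∘L
    ContinuousLinearMap.pi fun i => ∑ j, mulLp ν (Φ i j) ∘L PiLp.proj 2 (fun _ : ι => Lp ℂ 2 ν) j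

theorem matMulLp_apply (Φ : Matrix ι ι (X →ᵇ ℂ)) (F : PiLp 2 (fun _ : ι => Lp ℂ 2 ν)) (i : ι) :
    matMulLp ν Φ F i = ∑ j, mulLp ν (Φ i j) (F j) := by
  simp [matMulLp]

/-- Together with `matMulLp_one` and `matMulLp_conjTranspose` this gives a unital *-homomorphism,
which carries algebraic identities between symbols and operators. -/
theorem matMulLp_mul (Φ Ψ : Matrix ι ι (X →ᵇ ℂ)) :
    matMulLp ν (Φ * Ψ) = matMulLp ν Φ * matMulLp ν Ψ := by
  ext1 F
  refine PiLp.ext fun i => ?_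
  simp only [mul_apply_eq_comp, matMulLp_apply, Matrix.mul_apply, mulLp_sum, map_sum,
    mulLp_mul]
  exact Finset.sum_comm

theorem matMulLp_one [DecidableEq ι] : matMulLp ν (1 : Matrix ι ι (X →ᵇ ℂ)) = 1 := by
  ext1 F
  refine PiLp.ext fun i => ?_
  rw [matMulLp_apply, Finset.sum_eq_single i]
  · simp [mulLp_one]
  · intro j _ hj
    rw [Matrix.one_apply_ne hj.symm, mulLp_zero]
  · simp

theorem matMulLp_conjTranspose (Φ : Matrix ι ι (X →ᵇ ℂ)) :
    matMulLp ν Φ.conjTranspose = star (matMulLp ν Φ) := by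
  rw [ContinuousLinearMap.star_eq_adjoint, ContinuousLinearMap.eq_adjoint_iff]
  intro F G
  simp only [PiLp.inner_apply, matMulLp_apply, sum_inner, inner_sum, Matrix.conjTranspose_apply,
    mulLp_star_inner]
  exact Finset.sum_comm

/-- The entry `(i, j)` is recovered by applying the operator to a vector supported in coordinate `j`
and reading off coordinate `i`. -/
theorem matMulLp_injective [T2Space X] [SigmaFinite ν] [ν.IsOpenPosMeasure] :
    Function.Injective (matMulLp (ι := ι) ν) := by
  classical
  intro Φ Ψ h
  ext1 i j
  apply mulLp_injective (ν := ν)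
  ext1 f
  have hf : ∀ Θ : Matrix ι ι (X →ᵇ ℂ), matMulLp ν Θ (PiLp.single 2 j f) i = mulLp ν (Θ i j) f := by
    intro Θ
    rw [matMulLp_apply, Finset.sum_eq_single j]
    · simp
    · intro k _ hk
      simp [hk]
    · simp
  rw [← hf, ← hf, h]

theorem inner_matMulLp (Φ : Matrix ι ι (X →ᵇ ℂ)) (F : PiLp 2 (fun _ : ι => Lp ℂ 2 ν)) :
    ⟪F, matMulLp ν Φ F⟫_ℂ =
      ∫ x, star (fun i => F i x) ⬝ᵥ (Φ.map fun φ => φ x).mulVec (fun i => F i x) ∂ν := by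
  have hint : ∀ i j, Integrable (fun x => Φ i j x * ⟪F i x, F j x⟫_ℂ) ν := fun i j =>
    (L2.integrable_inner (F i) (F j)).bdd_mul (Φ i j).continuous.aestronglyMeasurable
      (Filter.Eventually.of_forall (Φ i j).norm_coe_le_norm)
  simp only [PiLp.inner_apply, matMulLp_apply, inner_sum, inner_mulLp]
  simp_rw [← integral_finsetSum _ fun j _ => hint _ j]
  rw [← integral_finsetSum _ fun i _ => integrable_finsetSum _ fun j _ => hint i j]
  refine integral_congr_ae (Filter.Eventually.of_forall fun x => ?_)
  simp only [dotProduct, Matrix.mulVec, Matrix.map_apply, Finset.mul_sum, Pi.star_apply,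
    RCLike.inner_apply, RCLike.star_def]
  refine Finset.sum_congr rfl fun i _ => Finset.sum_congr rfl fun j _ => ?_
  ring

end MultiplicationOperators

/-! ### Self-adjoint, unitary and positive multiplication operators. -/

section Positivity

variable {X : Type*} [TopologicalSpace X] [MeasurableSpace X] [BorelSpace X] {ν : Measure X}
  {ι : Type*} [Fintype ι]

theorem integrable_quadraticForm (Φ : Matrix ι ι (X →ᵇ ℂ)) (F : PiLp 2 (fun _ : ι => Lp ℂ 2 ν)) :
    Integrable (fun x => star (fun i => F i x) ⬝ᵥ (Φ.map fun φ => φ x).mulVec (fun i => F i x))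
      ν := by
  have hint : ∀ i j, Integrable (fun x => Φ i j x * ⟪F i x, F j x⟫_ℂ) ν := fun i j =>
    (L2.integrable_inner (F i) (F j)).bdd_mul (Φ i j).continuous.aestronglyMeasurable
      (Filter.Eventually.of_forall (Φ i j).norm_coe_le_norm)
  refine (integrable_finsetSum Finset.univ fun i _ =>
    integrable_finsetSum Finset.univ fun j _ => hint i j).congr
    (Filter.Eventually.of_forall fun x => ?_)
  simp only [dotProduct, Matrix.mulVec, Matrix.map_apply, Finset.mul_sum, Pi.star_apply,
    RCLike.inner_apply, RCLike.star_def]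
  refine Finset.sum_congr rfl fun i _ => Finset.sum_congr rfl fun j _ => ?_
  ring

omit [MeasurableSpace X] [BorelSpace X] in
theorem continuous_quadraticForm (Φ : Matrix ι ι (X →ᵇ ℂ)) (v : ι → ℂ) :
    Continuous fun x => star v ⬝ᵥ (Φ.map fun φ => φ x).mulVec v := by
  simp only [dotProduct, Matrix.mulVec, Matrix.map_apply]
  fun_prop

variable [T2Space X] [SigmaFinite ν] [ν.IsOpenPosMeasure]

theorem isSelfAdjoint_matMulLp_iff {Φ : Matrix ι ι (X →ᵇ ℂ)} :
    IsSelfAdjoint (matMulLp ν Φ) ↔ ∀ x, (Φ.map fun φ => φ x).IsHermitian := by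
  rw [IsSelfAdjoint, ← matMulLp_conjTranspose, matMulLp_injective.eq_iff]
  constructor
  · intro h x
    ext i j
    have := DFunLike.congr_fun (congrFun (congrFun h i) j) x
    simpa using this
  · intro h
    ext i j x
    simpa using congrFun (congrFun (h x) i) j

theorem matMulLp_mem_unitary_iff [DecidableEq ι] {Φ : Matrix ι ι (X →ᵇ ℂ)} :
    matMulLp ν Φ ∈ unitary (PiLp 2 (fun _ : ι => Lp ℂ 2 ν) →L[ℂ] PiLp 2 (fun _ : ι => Lp ℂ 2 ν)) ↔
      ∀ x, (Φ.map fun φ => φ x) ∈ Matrix.unitaryGroup ι ℂ := by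
  have hmap : ∀ (x : X) (Ψ Θ : Matrix ι ι (X →ᵇ ℂ)),
      (Ψ * Θ).map (fun φ => φ x) = Ψ.map (fun φ => φ x) * Θ.map (fun φ => φ x) := by
    intro x Ψ Θ
    ext i j
    simp [Matrix.mul_apply]
  have hstar : ∀ (x : X) (Ψ : Matrix ι ι (X →ᵇ ℂ)),
      Ψ.conjTranspose.map (fun φ => φ x) = star (Ψ.map (fun φ => φ x)) := by
    intro x Ψ
    ext i j
    simp
  have hone : ∀ x : X, (1 : Matrix ι ι (X →ᵇ ℂ)).map (fun φ => φ x) = 1 := by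
    intro x
    ext i j
    by_cases h : i = j <;> simp [Matrix.one_apply, h]
  have hext : ∀ Ψ Θ : Matrix ι ι (X →ᵇ ℂ),
      (∀ x, Ψ.map (fun φ => φ x) = Θ.map (fun φ => φ x)) → Ψ = Θ := by
    intro Ψ Θ h
    ext i j x
    exact congrFun (congrFun (h x) i) j
  simp only [Unitary.mem_iff]
  rw [← matMulLp_conjTranspose, ← matMulLp_mul, ← matMulLp_mul, ← matMulLp_one,
    matMulLp_injective.eq_iff, matMulLp_injective.eq_iff]
  constructor
  · rintro ⟨h₁, h₂⟩ x
    rw [← hstar, ← hmap, ← hmap, h₁, h₂, hone]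
    exact ⟨rfl, rfl⟩
  · intro h
    refine ⟨hext _ _ fun x => ?_, hext _ _ fun x => ?_⟩
    · rw [hmap, hstar, hone, (h x).1]
    · rw [hmap, hstar, hone, (h x).2]

/-- One direction integrates the pointwise quadratic forms. For the other, testing on `1_s v` with a
constant vector `v` shows that the form at `v` has nonnegative integral over every `s` of finite
measure, hence is nonnegative almost everywhere. -/
theorem matMulLp_isPositive_iff {Φ : Matrix ι ι (X →ᵇ ℂ)} :
    (matMulLp ν Φ).IsPositive ↔ ∀ x, (Φ.map fun φ => φ x).PosSemidef := by
  constructor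
  · intro h x
    refine Matrix.PosSemidef.of_dotProduct_mulVec_nonneg
      (isSelfAdjoint_matMulLp_iff.1 h.isSelfAdjoint x) fun v => ?_
    have hreal : ∀ x, (star v ⬝ᵥ (Φ.map fun φ => φ x).mulVec v).im = 0 := fun x =>
      (isSelfAdjoint_matMulLp_iff.1 h.isSelfAdjoint x).im_star_dotProduct_mulVec_self v
    have hset : ∀ s, MeasurableSet s → ν s < ∞ →
        IntegrableOn (fun x => star v ⬝ᵥ (Φ.map fun φ => φ x).mulVec v) s ν ∧
        0 ≤ ∫ x in s, (star v ⬝ᵥ (Φ.map fun φ => φ x).mulVec v).re ∂ν := by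
      intro s hs hνs
      let F : PiLp 2 (fun _ : ι => Lp ℂ 2 ν) :=
        WithLp.toLp 2 fun i => indicatorConstLp 2 hs hνs.ne (v i)
      have hF : (fun x => star (fun i => F i x) ⬝ᵥ
          (Φ.map fun φ => φ x).mulVec (fun i => F i x)) =ᵐ[ν]
          s.indicator fun x => star v ⬝ᵥ (Φ.map fun φ => φ x).mulVec v := by
        have : ∀ i, ∀ᵐ x ∂ν, F i x = s.indicator (fun _ => v i) x :=
          fun i => indicatorConstLp_coeFn (hs := hs) (hμs := hνs.ne)
        filter_upwards [ae_all_iff.2 this] with x hx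
        simp only [hx]
        by_cases hxs : x ∈ s
        · simp [hxs]
        · simp only [hxs, not_false_eq_true, Set.indicator_of_notMem]
          simp [dotProduct]
      have hi : IntegrableOn (fun x => star v ⬝ᵥ (Φ.map fun φ => φ x).mulVec v) s ν :=
        (integrable_indicator_iff hs).1 ((integrable_quadraticForm Φ F).congr hF)
      refine ⟨hi, ?_⟩
      have h2 := h.re_inner_nonneg_right F
      rw [inner_matMulLp, integral_congr_ae hF, integral_indicator hs] at h2
      exact h2.trans_eq (integral_re hi).symm
    have hae := ae_nonneg_of_forall_setIntegral_nonneg_of_sigmaFinite (μ := ν)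
      (f := fun x => (star v ⬝ᵥ (Φ.map fun φ => φ x).mulVec v).re)
      (fun s hs hνs => (hset s hs hνs).1.re) (fun s hs hνs => (hset s hs hνs).2)
    -- By continuity the exceptional set is open; being null, it is empty.
    have hopen : IsOpen {x | (star v ⬝ᵥ (Φ.map fun φ => φ x).mulVec v).re < 0} :=
      isOpen_lt (Complex.continuous_re.comp (continuous_quadraticForm Φ v)) continuous_const
    have hnull : ν {x | (star v ⬝ᵥ (Φ.map fun φ => φ x).mulVec v).re < 0} = 0 := by
      refine measure_mono_null (fun x hx => ?_) hae
      simpa using hx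
    rw [hopen.measure_eq_zero_iff ν] at hnull
    have hx : ¬ (star v ⬝ᵥ (Φ.map fun φ => φ x).mulVec v).re < 0 := fun hlt =>
      (Set.eq_empty_iff_forall_notMem.1 hnull x) hlt
    exact Complex.nonneg_iff.2 ⟨not_lt.1 hx, (hreal x).symm⟩
  · intro h
    have hsa : IsSelfAdjoint (matMulLp ν Φ) :=
      isSelfAdjoint_matMulLp_iff.2 fun x => (h x).isHermitian
    refine ContinuousLinearMap.isPositive_def'.2 ⟨hsa, fun F => ?_⟩
    rw [ContinuousLinearMap.reApplyInnerSelf_apply, ← inner_conj_symm, RCLike.conj_re,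
      inner_matMulLp]
    refine (integral_nonneg_of_ae (Filter.Eventually.of_forall fun x => ?_) :
      (0 : ℝ) ≤ ∫ x, (star (fun i => F i x) ⬝ᵥ
        (Φ.map fun φ => φ x).mulVec (fun i => F i x)).re ∂ν).trans_eq
      (integral_re (integrable_quadraticForm Φ F))
    exact (Complex.nonneg_iff.1 ((h x).dotProduct_mulVec_nonneg _)).1

end Positivity

/-! ### Translations and their averages as Fourier multipliers. -/

section FourierMultipliers

variable {E : Type*} [NormedAddCommGroup E] [InnerProductSpace ℝ E]

/-- The character `ξ ↦ exp (2π𝚤⟨b, ξ⟩)`. -/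
noncomputable def expChar (b : E) : E →ᵇ ℂ :=
  BoundedContinuousFunction.ofNormedAddCommGroup
    (fun ξ => Complex.exp (((2 * Real.pi * ⟪b, ξ⟫_ℝ : ℝ) : ℂ) * Complex.I))
    (by fun_prop) 1 fun ξ => (Complex.norm_exp_ofReal_mul_I _).le

theorem expChar_apply (b ξ : E) :
    expChar b ξ = Complex.exp (((2 * Real.pi * ⟪b, ξ⟫_ℝ : ℝ) : ℂ) * Complex.I) := rfl

theorem norm_expChar (b ξ : E) : ‖expChar b ξ‖ = 1 := Complex.norm_exp_ofReal_mul_I _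

variable [FiniteDimensional ℝ E] [MeasurableSpace E] [BorelSpace E]

/-- The translation `f ↦ f (· + b)` on `L²`. -/
noncomputable abbrev translateLp (b : E) (f : Lp ℂ 2 (volume : Measure E)) :
    Lp ℂ 2 (volume : Measure E) :=
  Lp.compMeasurePreserving (· + b) (measurePreserving_add_right volume b) f

/-- Both sides are continuous in `f`, so it suffices to treat Schwartz functions, where the
transform is an integral and a change of variables applies. -/
theorem fourier_translateLp (b : E) (f : Lp ℂ 2 (volume : Measure E)) :
    𝓕 (translateLp b f) = mulLp volume (expChar b) (𝓕 f) := by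
  refine DenseRange.induction_on
    (p := fun f : Lp ℂ 2 (volume : Measure E) =>
      𝓕 (translateLp b f) = mulLp volume (expChar b) (𝓕 f))
    (SchwartzMap.denseRange_toLpCLM (E := E) (F := ℂ) (p := 2) ENNReal.ofNat_ne_top) f ?_ ?_
  · refine isClosed_eq ?_ ?_
    · exact (Lp.fourierTransformₗᵢ E ℂ).continuous.comp
        (Lp.isometry_compMeasurePreserving _).continuous
    · exact (mulLp volume (expChar b)).continuous.comp (Lp.fourierTransformₗᵢ E ℂ).continuous
  · intro g
    have h1 : translateLp b (g.toLp 2) = (g.compSubConstCLM ℂ (-b)).toLp 2 := by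
      apply Lp.ext
      have hq := (measurePreserving_add_right (volume : Measure E) b).quasiMeasurePreserving
      filter_upwards [Lp.coeFn_compMeasurePreserving (g.toLp 2)
        (measurePreserving_add_right (volume : Measure E) b), hq.ae (g.coeFn_toLp 2 volume),
        (g.compSubConstCLM ℂ (-b)).coeFn_toLp 2] with x hx1 hx2 hx3
      rw [hx1, hx3, Function.comp_apply, hx2]
      simp
    change 𝓕 (translateLp b (g.toLp 2)) = mulLp volume (expChar b) (𝓕 (g.toLp 2))
    rw [h1, SchwartzMap.toLp_fourier_eq, SchwartzMap.toLp_fourier_eq]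
    apply Lp.ext
    filter_upwards [(𝓕 (g.compSubConstCLM ℂ (-b))).coeFn_toLp 2,
      coeFn_mulLp (expChar b) ((𝓕 g).toLp 2), (𝓕 g).coeFn_toLp 2] with ξ h2 h3 h4
    rw [h2, h3, h4, SchwartzMap.fourier_coe, SchwartzMap.fourier_coe]
    have h5 := congrFun (VectorFourier.fourierIntegral_comp_add_right Real.fourierChar
      (volume : Measure E) (innerₗ E) g b) ξ
    have h6 : ((g.compSubConstCLM ℂ (-b) : 𝓢(E, ℂ)) : E → ℂ) = g ∘ fun v => v + b := by
      funext v
      simp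
    rw [h6]
    refine h5.trans ?_
    rw [Circle.smul_def, Real.fourierChar_apply, expChar_apply, innerₗ_apply_apply, smul_eq_mul]
    rfl

variable {Ω : Type*} [MeasurableSpace Ω] {μ : Measure Ω} {κ : Ω → ℂ} {b : Ω → E}

theorem aestronglyMeasurable_expChar (hb : AEMeasurable b μ) (ξ : E) :
    AEStronglyMeasurable (fun u => expChar (b u) ξ) μ := by
  have : Continuous fun b : E => expChar b ξ := by
    simp only [expChar_apply]
    fun_prop
  exact this.comp_aestronglyMeasurable hb.aestronglyMeasurable

theorem integrable_mul_expChar (hκ : Integrable κ μ) (hb : AEMeasurable b μ) (ξ : E) :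
    Integrable (fun u => κ u * expChar (b u) ξ) μ :=
  hκ.mul_bdd (c := 1) (aestronglyMeasurable_expChar hb ξ)
    (Filter.Eventually.of_forall fun _ => (norm_expChar _ _).le)

/-- The inverse Fourier transform of the push-forward of the complex measure `κ μ` under `b`. -/
noncomputable def fourierSymbol (hκ : Integrable κ μ) (hb : AEMeasurable b μ) : E →ᵇ ℂ :=
  BoundedContinuousFunction.ofNormedAddCommGroup
    (fun ξ => ∫ u, κ u * expChar (b u) ξ ∂μ)
    (continuous_of_dominated (bound := fun u => ‖κ u‖)
      (fun ξ => (integrable_mul_expChar hκ hb ξ).aestronglyMeasurable)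
      (fun _ => Filter.Eventually.of_forall fun _ => by rw [norm_mul, norm_expChar, mul_one])
      hκ.norm (Filter.Eventually.of_forall fun _ => by fun_prop))
    (∫ u, ‖κ u‖ ∂μ) fun ξ => by
      refine (norm_integral_le_integral_norm _).trans_eq ?_
      simp_rw [norm_mul, norm_expChar, mul_one]

theorem fourierSymbol_apply (hκ : Integrable κ μ) (hb : AEMeasurable b μ) (ξ : E) :
    fourierSymbol hκ hb ξ = ∫ u, κ u * expChar (b u) ξ ∂μ := rfl

variable [SFinite μ]

/-- Fubini: `⟪g ξ, f ξ⟫` and `κ` are integrable and the character has modulus one. Working with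
inner products avoids integrating operator-valued functions. -/
theorem inner_mulLp_fourierSymbol (hκ : Integrable κ μ) (hb : AEMeasurable b μ)
    (f g : Lp ℂ 2 (volume : Measure E)) :
    ⟪g, mulLp volume (fourierSymbol hκ hb) f⟫_ℂ =
      ∫ u, κ u * ⟪g, mulLp volume (expChar (b u)) f⟫_ℂ ∂μ := by
  have hgf : Integrable (fun ξ => ⟪g ξ, f ξ⟫_ℂ) := L2.integrable_inner g f
  have hprod : Integrable (fun p : E × Ω => (κ p.2 * ⟪g p.1, f p.1⟫_ℂ) * expChar (b p.2) p.1)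
      (volume.prod μ) := by
    refine Integrable.mul_bdd (c := 1) ?_ ?_
      (Filter.Eventually.of_forall fun p => (norm_expChar _ _).le)
    · exact (hgf.mul_prod hκ).congr (Filter.Eventually.of_forall fun p => mul_comm _ _)
    · have hc : Continuous fun q : E × E => expChar q.2 q.1 := by
        simp only [expChar_apply]
        fun_prop
      have hm : AEMeasurable (fun p : E × Ω => (p.1, b p.2)) (volume.prod μ) :=
        measurable_fst.aemeasurable.prodMk hb.comp_snd
      exact (hc.measurable.comp_aemeasurable hm).aestronglyMeasurable
  simp_rw [inner_mulLp, fourierSymbol_apply, ← integral_const_mul, ← integral_mul_const]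
  rw [integral_integral_swap]
  · refine integral_congr_ae (Filter.Eventually.of_forall fun u => ?_)
    refine integral_congr_ae (Filter.Eventually.of_forall fun ξ => ?_)
    exact mul_assoc _ _ _
  · refine hprod.congr (Filter.Eventually.of_forall fun p => ?_)
    simp only [Function.uncurry]
    ring

/-- The Fourier multiplier on `L²` with symbol `φ`. -/
noncomputable def fourierMultiplier (φ : E →ᵇ ℂ) (f : Lp ℂ 2 (volume : Measure E)) :
    Lp ℂ 2 (volume : Measure E) :=
  (Lp.fourierTransformₗᵢ E ℂ).symm (mulLp volume φ (Lp.fourierTransformₗᵢ E ℂ f))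

theorem inner_fourierMultiplier_fourierSymbol (hκ : Integrable κ μ) (hb : AEMeasurable b μ)
    (f g : Lp ℂ 2 (volume : Measure E)) :
    ⟪g, fourierMultiplier (fourierSymbol hκ hb) f⟫_ℂ =
      ∫ u, κ u * ⟪g, translateLp (b u) f⟫_ℂ ∂μ := by
  rw [← (Lp.fourierTransformₗᵢ E ℂ).inner_map_map, fourierMultiplier,
    LinearIsometryEquiv.apply_symm_apply, inner_mulLp_fourierSymbol]
  refine integral_congr_ae (Filter.Eventually.of_forall fun u => ?_)
  change κ u * ⟪_, mulLp volume (expChar (b u)) (𝓕 f)⟫_ℂ = _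
  rw [← fourier_translateLp]
  exact congrArg (κ u * ·) ((Lp.fourierTransformₗᵢ E ℂ).inner_map_map g (translateLp (b u) f))

theorem aestronglyMeasurable_comp_add {f : E → ℂ} (hf : AEStronglyMeasurable f volume)
    (hb : AEMeasurable b μ) :
    AEStronglyMeasurable (fun p : Ω × E => f (p.2 + b p.1)) (μ.prod volume) := by
  -- With `b` replaced by a measurable version, `(u, y) ↦ (u, y + b u)` is a measure-preserving skew
  -- product, so composing with it respects the almost-everywhere class of `f`.
  have hm : Measurable (Function.uncurry fun (u : Ω) (y : E) => y + hb.mk b u) :=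
    measurable_snd.add (hb.measurable_mk.comp measurable_fst)
  have hq := Measure.quasiMeasurePreserving_snd.comp
    ((MeasurePreserving.id μ).skew_product (μc := (volume : Measure E)) hm
      (Filter.Eventually.of_forall fun u =>
        (measurePreserving_add_right volume (hb.mk b u)).map_eq)).quasiMeasurePreserving
  refine (hf.comp_quasiMeasurePreserving hq).congr ?_
  have hae := Measure.quasiMeasurePreserving_fst (μ := μ) (ν := (volume : Measure E)) |>.ae
    hb.ae_eq_mk
  filter_upwards [hae] with p hp
  simp [hp]

theorem integrable_mul_comp_add {f : E → ℂ} (hf : MemLp f 2 volume)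
    (hκ : Integrable κ μ) (hb : AEMeasurable b μ) {s : Set E} (hs : volume s < ∞) :
    Integrable (fun p : Ω × E => κ p.1 * f (p.2 + b p.1)) (μ.prod (volume.restrict s)) := by
  have hmeas : AEStronglyMeasurable (fun p : Ω × E => κ p.1 * f (p.2 + b p.1))
      (μ.prod (volume.restrict s)) :=
    (hκ.aestronglyMeasurable.comp_fst).mul ((aestronglyMeasurable_comp_add hf.1 hb).mono_ac
      (Measure.AbsolutelyContinuous.rfl.prod Measure.absolutelyContinuous_restrict))
  have : IsFiniteMeasure ((volume : Measure E).restrict s) := ⟨by simpa using hs⟩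
  have hft : ∀ c : E, MemLp (fun y => f (y + c)) 2 volume := fun c =>
    hf.comp_measurePreserving (measurePreserving_add_right volume c)
  have hsq : Integrable (fun y => ‖f y‖ ^ 2) := hf.integrable_norm_pow two_ne_zero
  have hi : ∀ c : E, Integrable (fun y => f (y + c)) (volume.restrict s) := fun c =>
    ((hft c).restrict s).integrable one_le_two
  -- From `t ≤ 1 + t²` and translation invariance: a bound uniform in `c`, so that only
  -- integrability of `κ` remains to be used.
  have hbd : ∀ c : E, ∫ y in s, ‖f (y + c)‖ ≤ volume.real s + ∫ y, ‖f y‖ ^ 2 := by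
    intro c
    have h1 : Integrable (fun y => ‖f (y + c)‖ ^ 2) := (hft c).integrable_norm_pow two_ne_zero
    calc ∫ y in s, ‖f (y + c)‖ ≤ ∫ y in s, (1 + ‖f (y + c)‖ ^ 2) := by
          refine integral_mono (hi c).norm ((integrable_const 1).add h1.restrict) fun y => ?_
          dsimp only
          nlinarith [sq_nonneg (‖f (y + c)‖ - 1)]
      _ = volume.real s + ∫ y in s, ‖f (y + c)‖ ^ 2 := by
          rw [integral_add (integrable_const 1) h1.restrict]
          simp
      _ ≤ volume.real s + ∫ y, ‖f (y + c)‖ ^ 2 := by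
          gcongr
          · exact Filter.Eventually.of_forall fun y => by positivity
          · exact Measure.restrict_le_self
      _ = _ := by rw [integral_add_right_eq_self fun y => ‖f y‖ ^ 2]
  refine (integrable_prod_iff hmeas).2 ⟨Filter.Eventually.of_forall fun u =>
    (hi (b u)).const_mul (κ u), ?_⟩
  refine (hκ.norm.mul_const (volume.real s + ∫ y, ‖f y‖ ^ 2)).mono'
    hmeas.norm.integral_prod_right' (Filter.Eventually.of_forall fun u => ?_)
  simp_rw [norm_mul, integral_const_mul]
  rw [norm_mul, norm_norm, Real.norm_of_nonneg (integral_nonneg fun _ => norm_nonneg _)]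
  exact mul_le_mul_of_nonneg_left (hbd _) (norm_nonneg _)

theorem ae_integrable_mul_comp_add {f : E → ℂ} (hf : MemLp f 2 volume)
    (hκ : Integrable κ μ) (hb : AEMeasurable b μ) :
    ∀ᵐ y, Integrable (fun u => κ u * f (y + b u)) μ := by
  refine ae_of_forall_measure_lt_top_ae_restrict _ fun s _ hs => ?_
  exact (integrable_mul_comp_add hf hκ hb hs).prod_left_ae

/-- The weak formula paired with indicators of finite-measure sets, followed by Fubini, shows that
both sides have the same integral over each such set. -/
theorem fourierMultiplier_fourierSymbol_ae_eq {f : E → ℂ} (hf : MemLp f 2 volume)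
    (hκ : Integrable κ μ) (hb : AEMeasurable b μ) :
    fourierMultiplier (fourierSymbol hκ hb) (hf.toLp f) =ᵐ[volume]
      fun y => ∫ u, κ u * f (y + b u) ∂μ := by
  refine ae_eq_of_forall_setIntegral_eq_of_sigmaFinite ?_ ?_ ?_
  · intro s _ hs
    have : IsFiniteMeasure ((volume : Measure E).restrict s) := ⟨by simpa using hs⟩
    exact ((Lp.memLp _).restrict s).integrable one_le_two
  · intro s _ hs
    exact (integrable_mul_comp_add hf hκ hb hs).integral_prod_right
  · intro s hms hs
    rw [← L2.inner_indicatorConstLp_one (𝕜 := ℂ) hms hs.ne, inner_fourierMultiplier_fourierSymbol,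
      integral_integral_swap (f := fun y u => κ u * f (y + b u))
        (integrable_mul_comp_add hf hκ hb hs).swap]
    refine integral_congr_ae (Filter.Eventually.of_forall fun u => ?_)
    dsimp only
    rw [L2.inner_indicatorConstLp_one, integral_const_mul]
    congr 1
    refine integral_congr_ae (ae_restrict_of_ae ?_)
    have hq := measurePreserving_add_right (volume : Measure E) (b u)
    filter_upwards [Lp.coeFn_compMeasurePreserving (hf.toLp f) hq,
      hq.quasiMeasurePreserving.ae hf.coeFn_toLp] with y h1 h2
    rw [h1, Function.comp_apply, h2]

end FourierMultipliers

/-! ### Logarithmic coordinates on the rotated hyperoctants. -/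

section OctantCoordinates

variable {n : ℕ}

theorem intUnit_sq (σ : ℤˣ) : ((σ : ℤ) : ℝ) * ((σ : ℤ) : ℝ) = 1 := by
  rcases Int.units_eq_one_or σ with rfl | rfl <;> norm_num

theorem intUnit_abs (σ : ℤˣ) : |((σ : ℤ) : ℝ)| = 1 := by
  rcases Int.units_eq_one_or σ with rfl | rfl <;> norm_num

/-- Logarithmic coordinates on the hyperoctant with sign pattern `σ`. -/
noncomputable def signedExp (σ : Fin n → ℤˣ) (y : Fin n → ℝ) : Fin n → ℝ :=
  fun k => ((σ k : ℤ) : ℝ) * Real.exp (y k)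

/-- Logarithmic coordinates on the image under `C` of the hyperoctant with sign pattern `σ`. -/
noncomputable def octantMap (C : Matrix (Fin n) (Fin n) ℝ) (σ : Fin n → ℤˣ) (y : Fin n → ℝ) :
    Fin n → ℝ :=
  C.mulVec (signedExp σ y)

theorem signedExp_inj {σ τ : Fin n → ℤˣ} {y z : Fin n → ℝ} (h : signedExp σ y = signedExp τ z) :
    σ = τ ∧ y = z := by
  have hk : ∀ k, σ k = τ k ∧ y k = z k := by
    intro k
    have h1 : ((σ k : ℤ) : ℝ) * Real.exp (y k) = ((τ k : ℤ) : ℝ) * Real.exp (z k) := congrFun h k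
    have h2 : Real.exp (y k) = Real.exp (z k) := by
      have := congrArg abs h1
      simpa [abs_mul, intUnit_abs] using this
    refine ⟨?_, Real.exp_injective h2⟩
    rw [h2] at h1
    have h3 := mul_right_cancel₀ (Real.exp_pos _).ne' h1
    exact Units.ext (by exact_mod_cast h3)
  exact ⟨funext fun k => (hk k).1, funext fun k => (hk k).2⟩

theorem exists_signedExp_eq {x : Fin n → ℝ} (hx : ∀ k, x k ≠ 0) : ∃ σ y, signedExp σ y = x := by
  refine ⟨fun k => if 0 < x k then 1 else -1, fun k => Real.log |x k|, funext fun k => ?_⟩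
  simp only [signedExp]
  rw [Real.exp_log (abs_pos.2 (hx k))]
  split_ifs with h
  · simp [abs_of_pos h]
  · simp [abs_of_neg (lt_of_le_of_ne (not_lt.1 h) (hx k))]

variable {C : Matrix (Fin n) (Fin n) ℝ} (hC : C ∈ Matrix.orthogonalGroup (Fin n) ℝ)

theorem continuous_octantMap (C : Matrix (Fin n) (Fin n) ℝ) (σ : Fin n → ℤˣ) :
    Continuous (octantMap C σ) := by
  unfold octantMap signedExp
  fun_prop

include hC

theorem octantMap_inj {σ τ : Fin n → ℤˣ} {y z : Fin n → ℝ}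
    (h : octantMap C σ y = octantMap C τ z) : σ = τ ∧ y = z := by
  apply signedExp_inj
  have h1 := congrArg (star C).mulVec h
  simpa [octantMap, Matrix.mulVec_mulVec, Matrix.mem_unitaryGroup_iff'.1 hC] using h1

theorem abs_det_of_mem_orthogonalGroup : |C.det| = 1 := by
  have h := congrArg Matrix.det (Matrix.mem_unitaryGroup_iff.1 hC)
  rw [Matrix.det_mul, Matrix.star_eq_conjTranspose, Matrix.det_conjTranspose, Matrix.det_one,
    star_trivial] at h
  rcases mul_self_eq_one_iff.1 h with h | h <;> simp [h]

theorem measurableEmbedding_octantMap (σ : Fin n → ℤˣ) : MeasurableEmbedding (octantMap C σ) :=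
  (continuous_octantMap C σ).measurableEmbedding fun _ _ h => (octantMap_inj hC h).2

/-- Change of variables: the derivative at `y` is `C * diagonal (σ e^y)`, whose determinant has
absolute value `e^{∑ y}` because `C` is orthogonal. -/
theorem map_octantMap (σ : Fin n → ℤˣ) :
    Measure.map (octantMap C σ)
      ((volume : Measure (Fin n → ℝ)).withDensity fun y => ENNReal.ofReal (Real.exp (∑ k, y k))) =
    volume.restrict (Set.range (octantMap C σ)) := by
  have hderiv : ∀ y, HasFDerivAt (octantMap C σ)
      (LinearMap.toContinuousLinearMap
        (Matrix.toLin' (C * Matrix.diagonal (signedExp σ y)))) y := by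
    intro y
    have h1 : HasFDerivAt (signedExp σ)
        (LinearMap.toContinuousLinearMap (Matrix.toLin' (Matrix.diagonal (signedExp σ y)))) y := by
      rw [hasFDerivAt_pi']
      intro k
      have h2 : HasFDerivAt (fun z : Fin n → ℝ => z k)
          (ContinuousLinearMap.proj (R := ℝ) (φ := fun _ : Fin n => ℝ) k) y :=
        hasFDerivAt_apply k y
      refine (h2.exp.const_mul ((σ k : ℤ) : ℝ)).congr_fderiv ?_
      ext z
      simp [signedExp, Matrix.mulVec_diagonal, mul_assoc]
    have h3 := ((LinearMap.toContinuousLinearMap (Matrix.toLin' C)).hasFDerivAt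
      (x := signedExp σ y)).comp y h1
    refine h3.congr_fderiv ?_
    ext z
    simp [Matrix.mulVec_mulVec]
  have hdet : ∀ y, |(LinearMap.toContinuousLinearMap
      (Matrix.toLin' (C * Matrix.diagonal (signedExp σ y)))).det| = Real.exp (∑ k, y k) := by
    intro y
    rw [LinearMap.det_toContinuousLinearMap, LinearMap.det_toLin', Matrix.det_mul, abs_mul,
      abs_det_of_mem_orthogonalGroup hC, one_mul, Matrix.det_diagonal, Finset.abs_prod,
      Real.exp_sum]
    simp [signedExp, abs_mul, intUnit_abs]
  have h := map_withDensity_abs_det_fderiv_eq_addHaar (volume : Measure (Fin n → ℝ))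
    (s := Set.univ) MeasurableSet.univ.nullMeasurableSet
    (fun y _ => (hderiv y).hasFDerivWithinAt)
    (fun _ _ _ _ h => (octantMap_inj hC h).2)
  simp_rw [hdet, Measure.restrict_univ, Set.image_univ] at h
  exact h

variable {ι : Type*} [Fintype ι] (e : ι ≃ (Fin n → ℤˣ))

/-- The rotated hyperoctants are disjoint and miss only the points `x` for which `Cᵀ x` has a zero
coordinate, a null set. -/
theorem volume_eq_sum_map_octantMap :
    (volume : Measure (Fin n → ℝ)) = Measure.sum fun i => Measure.map (octantMap C (e i))
      ((volume : Measure (Fin n → ℝ)).withDensity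
        fun y => ENNReal.ofReal (Real.exp (∑ k, y k))) := by
  simp_rw [map_octantMap hC]
  rw [← Measure.restrict_iUnion]
  · symm
    apply Measure.restrict_eq_self_of_ae_mem
    have hdet : (star C).det ≠ 0 := by
      have := abs_det_of_mem_orthogonalGroup (Unitary.star_mem hC)
      intro h
      simp [h] at this
    have hq : Measure.QuasiMeasurePreserving (Matrix.toLin' (star C)) volume volume := by
      refine ⟨(LinearMap.continuous_of_finiteDimensional _).measurable, ?_⟩
      rw [Real.map_matrix_volume_pi_eq_smul_volume_pi hdet]
      exact Measure.smul_absolutelyContinuous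
    have hne : ∀ᵐ x : Fin n → ℝ, ∀ k, x k ≠ 0 :=
      ae_all_iff.2 fun k => Measure.ae_eval_ne (fun _ : Fin n => (volume : Measure ℝ)) k 0
    filter_upwards [hq.ae hne] with x hx
    obtain ⟨σ, y, h⟩ := exists_signedExp_eq hx
    refine Set.mem_iUnion.2 ⟨e.symm σ, y, ?_⟩
    rw [octantMap, Equiv.apply_symm_apply, h, Matrix.toLin'_apply, Matrix.mulVec_mulVec,
      Matrix.mem_unitaryGroup_iff.1 hC, Matrix.one_mulVec]
  · intro i j hij
    rw [Function.onFun, Set.disjoint_left]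
    rintro _ ⟨y, rfl⟩ ⟨z, h⟩
    exact hij (e.injective (octantMap_inj hC h).1.symm)
  · intro i
    exact (measurableEmbedding_octantMap hC (e i)).measurableSet_range

/-- The density `e^{∑ y}` is positive, so it has the null sets of Lebesgue measure. The parameter
space is Euclidean because the Fourier transform needs the inner product. -/
theorem ae_iff_forall_ae_octantMap {p : (Fin n → ℝ) → Prop} :
    (∀ᵐ x, p x) ↔ ∀ i, ∀ᵐ y : EuclideanSpace ℝ (Fin n), p (octantMap C (e i) y.ofLp) := by
  rw [volume_eq_sum_map_octantMap hC e, Measure.ae_sum_iff]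
  refine forall_congr' fun i => ?_
  rw [(measurableEmbedding_octantMap hC (e i)).ae_map_iff]
  have h1 : (volume : Measure (Fin n → ℝ)) ≪ volume.withDensity
      fun y => ENNReal.ofReal (Real.exp (∑ k, y k)) :=
    withDensity_absolutelyContinuous' (by fun_prop)
      (Filter.Eventually.of_forall fun y => by simp [Real.exp_pos])
  have h2 : ∀ q : (Fin n → ℝ) → Prop, (∀ᵐ y ∂(volume.withDensity
      fun y : Fin n → ℝ => ENNReal.ofReal (Real.exp (∑ k, y k))), q y) ↔ ∀ᵐ y, q y :=
    fun q => ⟨fun h => h1.ae_le h, fun h => (withDensity_absolutelyContinuous _ _).ae_le h⟩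
  rw [h2, ← (PiLp.volume_preserving_ofLp (Fin n)).map_eq]
  exact (MeasurableEquiv.toLp 2 (Fin n → ℝ)).symm.measurableEmbedding.ae_map_iff

theorem aestronglyMeasurable_iff_octantMap {f : (Fin n → ℝ) → ℂ} :
    AEStronglyMeasurable f volume ↔ ∀ i, AEStronglyMeasurable
      (fun y : EuclideanSpace ℝ (Fin n) => f (octantMap C (e i) y.ofLp)) volume := by
  rw [volume_eq_sum_map_octantMap hC e, aestronglyMeasurable_sum_measure_iff]
  refine forall_congr' fun i => ?_
  rw [(measurableEmbedding_octantMap hC (e i)).aestronglyMeasurable_map_iff]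
  have h1 : (volume : Measure (Fin n → ℝ)) ≪ volume.withDensity
      fun y => ENNReal.ofReal (Real.exp (∑ k, y k)) :=
    withDensity_absolutelyContinuous' (by fun_prop)
      (Filter.Eventually.of_forall fun y => by simp [Real.exp_pos])
  have h2 : ∀ g : (Fin n → ℝ) → ℂ, AEStronglyMeasurable g (volume.withDensity
      fun y : Fin n → ℝ => ENNReal.ofReal (Real.exp (∑ k, y k))) ↔
      AEStronglyMeasurable g volume :=
    fun g => ⟨fun h => h.mono_ac h1, fun h => h.mono_ac (withDensity_absolutelyContinuous _ _)⟩
  rw [h2, ← (PiLp.volume_preserving_ofLp (Fin n)).map_eq]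
  exact (MeasurableEquiv.toLp 2 (Fin n → ℝ)).symm.measurableEmbedding.aestronglyMeasurable_map_iff

theorem lintegral_eq_sum_octantMap (g : (Fin n → ℝ) → ℝ≥0∞) :
    ∫⁻ x, g x = ∑ i, ∫⁻ y : EuclideanSpace ℝ (Fin n),
      ENNReal.ofReal (Real.exp (∑ k, y k)) * g (octantMap C (e i) y.ofLp) := by
  rw [volume_eq_sum_map_octantMap hC e, lintegral_sum_measure, tsum_fintype]
  refine Finset.sum_congr rfl fun i _ => ?_
  rw [(measurableEmbedding_octantMap hC (e i)).lintegral_map,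
    lintegral_withDensity_eq_lintegral_mul_non_measurable _ (by fun_prop)
      (Filter.Eventually.of_forall fun _ => ENNReal.ofReal_lt_top)]
  exact ((PiLp.volume_preserving_ofLp (Fin n)).lintegral_comp_emb
    (MeasurableEquiv.toLp 2 (Fin n → ℝ)).symm.measurableEmbedding _).symm

omit hC in
/-- The function `f` in logarithmic coordinates on one hyperoctant, with the weight that makes
`f ↦ octantPullback C σ f` isometric on functions supported in that hyperoctant. -/
noncomputable def octantPullback (C : Matrix (Fin n) (Fin n) ℝ) (σ : Fin n → ℤˣ)
    (f : (Fin n → ℝ) → ℂ) (y : EuclideanSpace ℝ (Fin n)) : ℂ :=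
  ((Real.exp ((∑ k, y k) / 2) : ℝ) : ℂ) * f (octantMap C σ y.ofLp)

omit hC in
theorem eLpNorm_two_sq {α : Type*} [MeasurableSpace α] {ν : Measure α} (f : α → ℂ) :
    eLpNorm f 2 ν ^ 2 = ∫⁻ x, ‖f x‖ₑ ^ 2 ∂ν := by
  have := eLpNorm_nnreal_pow_eq_lintegral (f := f) (μ := ν) (p := 2) two_ne_zero
  simpa using this

theorem eLpNorm_sq_eq_sum_octantPullback (f : (Fin n → ℝ) → ℂ) :
    eLpNorm f 2 volume ^ 2 = ∑ i, eLpNorm (octantPullback C (e i) f) 2 volume ^ 2 := by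
  simp_rw [eLpNorm_two_sq]
  rw [lintegral_eq_sum_octantMap hC e]
  refine Finset.sum_congr rfl fun i _ => lintegral_congr fun y => ?_
  rw [octantPullback, enorm_mul, mul_pow]
  congr 1
  rw [← ofReal_norm, ← ENNReal.ofReal_pow (norm_nonneg _), Complex.norm_real,
    Real.norm_of_nonneg (Real.exp_pos _).le, ← Real.exp_nat_mul]
  congr 2
  push_cast
  ring

omit hC in
theorem octantPullback_aestronglyMeasurable_iff {σ : Fin n → ℤˣ} {f : (Fin n → ℝ) → ℂ} :
    AEStronglyMeasurable (octantPullback C σ f) volume ↔ AEStronglyMeasurable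
      (fun y : EuclideanSpace ℝ (Fin n) => f (octantMap C σ y.ofLp)) volume := by
  have h1 : Continuous fun y : EuclideanSpace ℝ (Fin n) =>
      ((Real.exp ((∑ k, y k) / 2) : ℝ) : ℂ) := by fun_prop
  have h2 : Continuous fun y : EuclideanSpace ℝ (Fin n) =>
      ((Real.exp (-((∑ k, y k) / 2)) : ℝ) : ℂ) := by fun_prop
  constructor
  · intro h
    refine (h2.aestronglyMeasurable.mul h).congr (Filter.Eventually.of_forall fun y => ?_)
    simp only [octantPullback, Pi.mul_apply]
    rw [← mul_assoc, ← Complex.ofReal_mul, ← Real.exp_add]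
    simp
  · intro h
    refine (h1.aestronglyMeasurable.mul h).congr (Filter.Eventually.of_forall fun y => ?_)
    simp [octantPullback]

theorem memLp_iff_octantPullback {f : (Fin n → ℝ) → ℂ} :
    MemLp f 2 volume ↔ ∀ i, MemLp (octantPullback C (e i) f) 2 volume := by
  have hlt : eLpNorm f 2 volume < ∞ ↔
      ∀ i, eLpNorm (octantPullback C (e i) f) 2 volume < ∞ := by
    have h1 : ∀ a : ℝ≥0∞, a < ∞ ↔ a ^ 2 < ∞ := fun a => by simp
    rw [h1, eLpNorm_sq_eq_sum_octantPullback hC e, ENNReal.sum_lt_top]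
    simp
  simp only [MemLp, hlt, aestronglyMeasurable_iff_octantMap hC e,
    octantPullback_aestronglyMeasurable_iff, forall_and]

/-- The `L²` functions on `ℝⁿ` in logarithmic coordinates on the hyperoctants. -/
noncomputable def octantIsometry :
    L2Space n →ₗᵢ[ℂ] PiLp 2 fun _ : ι => Lp ℂ 2 (volume : Measure (EuclideanSpace ℝ (Fin n))) where
  toFun f := WithLp.toLp 2 fun i =>
    ((memLp_iff_octantPullback hC e).1 (Lp.memLp f) i).toLp (octantPullback C (e i) f)
  map_add' f g := by
    refine PiLp.ext fun i => ?_
    simp only [PiLp.add_apply]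
    rw [← MemLp.toLp_add]
    refine MemLp.toLp_congr _ _ ?_
    filter_upwards [(ae_iff_forall_ae_octantMap hC e).1 (Lp.coeFn_add f g) i] with y hy
    simp only [octantPullback, hy, Pi.add_apply, mul_add]
  map_smul' c f := by
    refine PiLp.ext fun i => ?_
    simp only [PiLp.smul_apply, RingHom.id_apply]
    rw [← MemLp.toLp_const_smul]
    refine MemLp.toLp_congr _ _ ?_
    filter_upwards [(ae_iff_forall_ae_octantMap hC e).1 (Lp.coeFn_smul c f) i] with y hy
    simp only [octantPullback, hy, Pi.smul_apply, smul_eq_mul]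
    ring
  norm_map' f := by
    rw [← sq_eq_sq₀ (norm_nonneg _) (norm_nonneg _)]
    simp only [LinearMap.coe_mk, AddHom.coe_mk]
    rw [PiLp.norm_sq_eq_of_L2, Lp.norm_def f, ← ENNReal.toReal_pow,
      eLpNorm_sq_eq_sum_octantPullback hC e, ENNReal.toReal_sum]
    · simp only [Lp.norm_toLp, ENNReal.toReal_pow]
    · intro i _
      exact ENNReal.pow_ne_top ((memLp_iff_octantPullback hC e).1 (Lp.memLp f) i).2.ne

theorem octantIsometry_toLp {f : (Fin n → ℝ) → ℂ} (hf : MemLp f 2 volume) (i : ι) :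
    octantIsometry hC e (hf.toLp f) i =
      ((memLp_iff_octantPullback hC e).1 hf i).toLp (octantPullback C (e i) f) := by
  refine MemLp.toLp_congr ((memLp_iff_octantPullback hC e).1 (Lp.memLp (hf.toLp f)) i) _ ?_
  filter_upwards [(ae_iff_forall_ae_octantMap hC e).1 hf.coeFn_toLp i] with y hy
  simp only [octantPullback, hy]

theorem octantIsometry_surjective : Function.Surjective (octantIsometry hC e) := by
  intro G
  let g : ι → (Fin n → ℝ) → ℂ := fun i y =>
    ((Real.exp (-((∑ k, y k) / 2)) : ℝ) : ℂ) * G i (WithLp.toLp 2 y)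
  -- Glue the components with the weight removed, each extended by zero; the images are disjoint, so
  -- at most one summand is nonzero at each point.
  let f : (Fin n → ℝ) → ℂ := fun x => ∑ i, Function.extend (octantMap C (e i)) (g i) 0 x
  have hf : ∀ i, octantPullback C (e i) f = G i := by
    intro i
    funext y
    have h1 : f (octantMap C (e i) y.ofLp) = g i y.ofLp := by
      refine (Finset.sum_eq_single i (fun j _ hj => ?_) (by simp)).trans ?_
      · refine Function.extend_apply' _ _ _ ?_
        rintro ⟨z, hz⟩
        exact hj (e.injective (octantMap_inj hC hz).1)
      · exact (measurableEmbedding_octantMap hC (e i)).injective.extend_apply _ _ _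
    simp only [octantPullback, h1, g]
    rw [← mul_assoc, ← Complex.ofReal_mul, ← Real.exp_add]
    simp
  have hmem : MemLp f 2 volume :=
    (memLp_iff_octantPullback hC e).2 fun i => (hf i).symm ▸ Lp.memLp (G i)
  refine ⟨hmem.toLp f, PiLp.ext fun i => ?_⟩
  rw [octantIsometry_toLp hC e hmem i, ← Lp.toLp_coeFn (G i) (Lp.memLp (G i))]
  exact MemLp.toLp_congr _ _ (Filter.Eventually.of_forall fun y => congrFun (hf i) y)

/-- The unitary transform that diagonalizes Hausdorff operators: logarithmic coordinates on each
hyperoctant, followed by the Fourier transform. -/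
noncomputable def octantMellin :
    L2Space n ≃ₗᵢ[ℂ] PiLp 2 fun _ : ι => Lp ℂ 2 (volume : Measure (EuclideanSpace ℝ (Fin n))) :=
  (LinearIsometryEquiv.ofSurjective (octantIsometry hC e) (octantIsometry_surjective hC e)).trans
    (LinearIsometryEquiv.piLpCongrRight 2 fun _ => Lp.fourierTransformₗᵢ _ ℂ)

theorem octantMellin_apply (f : L2Space n) (i : ι) :
    octantMellin hC e f i = Lp.fourierTransformₗᵢ _ ℂ (octantIsometry hC e f i) := rfl

end OctantCoordinates

/-! ### The Hausdorff operator in logarithmic coordinates. -/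

section HausdorffOperators

variable {n : ℕ}

theorem sign_eq_intUnit_iff (x : ℝ) (σ : ℤˣ) :
    Real.sign x = ((σ : ℤ) : ℝ) ↔ 0 < ((σ : ℤ) : ℝ) * x := by
  rcases lt_trichotomy x 0 with h | rfl | h
  · rw [Real.sign_of_neg h]
    rcases Int.units_eq_one_or σ with rfl | rfl <;> norm_num <;> linarith
  · rcases Int.units_eq_one_or σ with rfl | rfl <;> norm_num
  · rw [Real.sign_of_pos h]
    rcases Int.units_eq_one_or σ with rfl | rfl <;> norm_num <;> linarith

theorem intUnit_mul_abs {x : ℝ} {σ : ℤˣ} (h : 0 < ((σ : ℤ) : ℝ) * x) :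
    ((σ : ℤ) : ℝ) * |x| = x := by
  rcases Int.units_eq_one_or σ with rfl | rfl
  · norm_num at h ⊢
    exact h.le
  · norm_num at h ⊢
    rw [abs_of_neg h, neg_neg]

/-- The vector of logarithms of the absolute values of the coordinates. -/
noncomputable def logAbs (b : Fin n → ℝ) : EuclideanSpace ℝ (Fin n) :=
  WithLp.toLp 2 fun k => Real.log |b k|

theorem abs_prod_rpow_neg_half {b : Fin n → ℝ} (hb : ∀ k, b k ≠ 0) :
    |∏ k, b k| ^ (-(1 / 2) : ℝ) = Real.exp (-(∑ k, logAbs b k) / 2) := by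
  have h : |∏ k, b k| = Real.exp (∑ k, logAbs b k) := by
    rw [Finset.abs_prod, Real.exp_sum]
    exact Finset.prod_congr rfl fun k _ => (Real.exp_log (abs_pos.2 (hb k))).symm
  rw [h, ← Real.exp_mul]
  congr 1
  ring

/-- The substitution `s = -2πξ` matches `|b|^{-𝚤 s}` with the character `e^{2π𝚤⟨log |b|, ξ⟩}`. -/
theorem absCpow_eq {b : Fin n → ℝ} (hb : ∀ k, b k ≠ 0) (ξ : EuclideanSpace ℝ (Fin n)) :
    absCpow b (fun k => -(2 * Real.pi) * ξ k) =
      ((|∏ k, b k| ^ (-(1 / 2) : ℝ) : ℝ) : ℂ) * expChar (logAbs b) ξ := by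
  rw [abs_prod_rpow_neg_half hb, expChar_apply, absCpow, ← Complex.exp_sum, Complex.ofReal_exp,
    ← Complex.exp_add]
  congr 1
  simp only [PiLp.inner_apply, RCLike.inner_apply, conj_trivial, logAbs]
  push_cast
  rw [neg_div, Finset.sum_div, ← Finset.sum_neg_distrib, Finset.mul_sum, Finset.sum_mul,
    ← Finset.sum_add_distrib]
  refine Finset.sum_congr rfl fun k _ => ?_
  ring

variable {Ω : Type*} {A : Ω → Matrix (Fin n) (Fin n) ℝ} {C : Matrix (Fin n) (Fin n) ℝ}
  {a : Ω → Fin n → ℝ}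

namespace IsSimultaneousDiagonalization

variable (h : IsSimultaneousDiagonalization A C a)
include h

theorem inv_eq_star : C⁻¹ = star C :=
  Matrix.inv_eq_left_inv (Matrix.mem_unitaryGroup_iff'.1 h.orthogonal)

theorem mul_eq (u : Ω) : A u * C = C * Matrix.diagonal (a u) := by
  rw [← h.diag u, ← mul_assoc, ← mul_assoc, h.inv_eq_star,
    Matrix.mem_unitaryGroup_iff.1 h.orthogonal, one_mul]

theorem det_eq (u : Ω) : (A u).det = ∏ k, a u k := by
  have hdet := abs_det_of_mem_orthogonalGroup h.orthogonal
  have hne : C.det ≠ 0 := by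
    intro h0
    simp [h0] at hdet
  have h1 := congrArg Matrix.det (h.mul_eq u)
  rw [Matrix.det_mul, Matrix.det_mul, Matrix.det_diagonal, mul_comm] at h1
  exact mul_left_cancel₀ hne h1

theorem aemeasurable [MeasurableSpace Ω] {μ : Measure Ω}
    (hA : ∀ i j, AEMeasurable (fun u => A u i j) μ) (k : Fin n) :
    AEMeasurable (fun u => a u k) μ := by
  have h1 : (fun u => a u k) = fun u => ∑ j, (∑ i, C⁻¹ k i * A u i j) * C j k := by
    funext u
    have := congrFun (congrFun (h.diag u) k) k
    rw [Matrix.diagonal_apply_eq] at this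
    rw [← this]
    simp [Matrix.mul_apply]
  rw [h1]
  exact Finset.aemeasurable_fun_sum _ fun j _ => AEMeasurable.mul_const
    (Finset.aemeasurable_fun_sum _ fun i _ => (hA i j).const_mul _) _

/-- The action of `A u` in logarithmic coordinates on the hyperoctants. -/
theorem mulVec_octantMap {e : Fin (2 ^ n) ≃ (Fin n → ℤˣ)} {i j : Fin (2 ^ n)} {u : Ω}
    (hu : u ∈ signSet a e i j) (y : EuclideanSpace ℝ (Fin n)) :
    (A u).mulVec (octantMap C (e i) y.ofLp) = octantMap C (e j) (y + logAbs (a u)).ofLp := by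
  rw [octantMap, Matrix.mulVec_mulVec, h.mul_eq, ← Matrix.mulVec_mulVec, octantMap]
  congr 1
  funext k
  have hk := (sign_eq_intUnit_iff _ _).1 (hu k)
  have hne : a u k ≠ 0 := fun h0 => by simp [h0] at hk
  rw [Matrix.mulVec_diagonal]
  simp only [signedExp, WithLp.ofLp_add, Pi.add_apply, logAbs, Real.exp_add,
    Real.exp_log (abs_pos.2 hne)]
  nth_rw 1 [← intUnit_mul_abs hk]
  simp only [octantSign, Units.val_mul, Int.cast_mul]
  linear_combination (((e j k : ℤ) : ℝ) * |a u k| * Real.exp (y k)) * intUnit_sq (e i k)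

end IsSimultaneousDiagonalization

theorem ne_zero_of_mem_signSet {e : Fin (2 ^ n) ≃ (Fin n → ℤˣ)} {i j : Fin (2 ^ n)} {u : Ω}
    (hu : u ∈ signSet a e i j) (k : Fin n) : a u k ≠ 0 := by
  intro h0
  have hk := (sign_eq_intUnit_iff _ _).1 (hu k)
  simp [h0] at hk

theorem exists_mem_signSet (e : Fin (2 ^ n) ≃ (Fin n → ℤˣ)) (i : Fin (2 ^ n)) {u : Ω}
    (hu : ∀ k, a u k ≠ 0) : ∃ j, u ∈ signSet a e i j := by
  -- Signs square to one, so `ε(i, j) = sgn a` forces `e j = e i * sgn a`.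
  refine ⟨e.symm fun k => e i k * (if 0 < a u k then 1 else -1), fun k => ?_⟩
  rw [sign_eq_intUnit_iff]
  simp only [octantSign, Equiv.apply_symm_apply]
  rw [← mul_assoc, Int.units_mul_self, one_mul]
  split_ifs with h
  · simpa using h
  · simpa using lt_of_le_of_ne (not_lt.1 h) (hu k)

theorem signSet_disjoint {e : Fin (2 ^ n) ≃ (Fin n → ℤˣ)} {i j j' : Fin (2 ^ n)} {u : Ω}
    (hj : u ∈ signSet a e i j) (hj' : u ∈ signSet a e i j') : j = j' := by
  apply e.injective
  funext k
  have h1 : ((octantSign e i j k : ℤ) : ℝ) = ((octantSign e i j' k : ℤ) : ℝ) :=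
    (hj k).symm.trans (hj' k)
  have h2 : octantSign e i j k = octantSign e i j' k := Units.ext (by exact_mod_cast h1)
  exact mul_left_cancel h2

variable [MeasurableSpace Ω] {μ : Measure Ω} {K : Ω → ℂ}

theorem nullMeasurableSet_signSet (ha : ∀ k, AEMeasurable (fun u => a u k) μ)
    (e : Fin (2 ^ n) ≃ (Fin n → ℤˣ)) (i j : Fin (2 ^ n)) :
    NullMeasurableSet (signSet a e i j) μ := by
  have h1 : signSet a e i j = ⋂ k, {u | 0 < ((octantSign e i j k : ℤ) : ℝ) * a u k} := by
    ext u
    simp only [signSet, Set.mem_ofPred_eq, Set.mem_iInter, sign_eq_intUnit_iff]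
  rw [h1]
  exact NullMeasurableSet.iInter fun k =>
    nullMeasurableSet_lt aemeasurable_const ((ha k).const_mul _)

theorem aemeasurable_logAbs (ha : ∀ k, AEMeasurable (fun u => a u k) μ) :
    AEMeasurable (fun u => logAbs (a u)) μ := by
  have h1 : AEMeasurable (fun u k => Real.log |a u k|) μ :=
    aemeasurable_pi_lambda _ fun k => Real.measurable_log.comp_aemeasurable
      (measurable_norm.comp_aemeasurable (ha k))
  exact (MeasurableEquiv.toLp 2 (Fin n → ℝ)).measurable.comp_aemeasurable h1

/-- The part of the density `|det A|^{-1/2} K` on the set which maps the `i`-th hyperoctant to the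
`j`-th one. -/
noncomputable def signDensity (K : Ω → ℂ) (a : Ω → Fin n → ℝ) (e : Fin (2 ^ n) ≃ (Fin n → ℤˣ))
    (i j : Fin (2 ^ n)) : Ω → ℂ :=
  (signSet a e i j).indicator fun u => ((|∏ k, a u k| ^ (-(1 / 2) : ℝ) : ℝ) : ℂ) * K u

variable (hint : Integrable (fun u => ((|∏ k, a u k| ^ (-(1 / 2) : ℝ) : ℝ) : ℂ) * K u) μ)
  (ha : ∀ k, AEMeasurable (fun u => a u k) μ) (e : Fin (2 ^ n) ≃ (Fin n → ℤˣ))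

include hint ha in
theorem integrable_signDensity (i j : Fin (2 ^ n)) : Integrable (signDensity K a e i j) μ :=
  hint.indicator₀ (nullMeasurableSet_signSet ha e i j)

/-- The matrix symbol, as a matrix of bounded continuous functions, in the normalization of the
Fourier transform. -/
noncomputable def continuousSymbol :
    Matrix (Fin (2 ^ n)) (Fin (2 ^ n)) (EuclideanSpace ℝ (Fin n) →ᵇ ℂ) :=
  Matrix.of fun i j =>
    fourierSymbol (integrable_signDensity hint ha e i j) (aemeasurable_logAbs ha)

theorem continuousSymbol_map (ξ : EuclideanSpace ℝ (Fin n)) :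
    (continuousSymbol hint ha e).map (fun φ => φ ξ) =
      matrixSymbol μ K a e fun k => -(2 * Real.pi) * ξ k := by
  ext i j
  simp only [continuousSymbol, Matrix.map_apply, Matrix.of_apply, matrixSymbol]
  rw [fourierSymbol_apply, ← integral_indicator₀ (nullMeasurableSet_signSet ha e i j)]
  refine integral_congr_ae (Filter.Eventually.of_forall fun u => ?_)
  by_cases hu : u ∈ signSet a e i j
  · simp only [signDensity, Set.indicator_of_mem hu]
    rw [absCpow_eq (ne_zero_of_mem_signSet hu)]
    ring
  · simp only [signDensity, Set.indicator_of_notMem hu, zero_mul]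

theorem forall_continuousSymbol_map_iff {p : Matrix (Fin (2 ^ n)) (Fin (2 ^ n)) ℂ → Prop} :
    (∀ ξ, p ((continuousSymbol hint ha e).map fun φ => φ ξ)) ↔
      ∀ s, p (matrixSymbol μ K a e s) := by
  simp only [continuousSymbol_map]
  refine ⟨fun h s => ?_, fun h ξ => h _⟩
  -- The point `ξ` solving `-2πξ = s`.
  have h1 := h (WithLp.toLp 2 fun k => -(2 * Real.pi)⁻¹ * s k)
  convert h1 using 2
  funext k
  have := Real.pi_pos
  field_simp

variable (h : IsSimultaneousDiagonalization A C a)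

/-- The operator which the unitary transform `octantMellin` turns into multiplication by the matrix
symbol. -/
noncomputable def hausdorffOperator : L2Space n →L[ℂ] L2Space n :=
  (octantMellin h.orthogonal e).symm.conjStarAlgEquiv
    (matMulLp volume (continuousSymbol hint ha e))

theorem octantIsometry_hausdorffOperator (f : L2Space n) (i : Fin (2 ^ n)) :
    octantIsometry h.orthogonal e (hausdorffOperator hint ha e h f) i =
      ∑ j, fourierMultiplier (continuousSymbol hint ha e i j)
        (octantIsometry h.orthogonal e f j) := by
  have h1 : octantMellin h.orthogonal e (hausdorffOperator hint ha e h f) =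
      matMulLp volume (continuousSymbol hint ha e) (octantMellin h.orthogonal e f) := by
    simp [hausdorffOperator]
  have h2 := congrArg (fun F => F i) h1
  simp only [matMulLp_apply, octantMellin_apply] at h2
  apply (Lp.fourierTransformₗᵢ (EuclideanSpace ℝ (Fin n)) ℂ).injective
  rw [h2, map_sum]
  simp only [fourierMultiplier, LinearIsometryEquiv.apply_symm_apply]

-- Exactly one `j` contributes when `K u ≠ 0`, and the weight splits as `e^{∑ y / 2} = |det A
-- u|^{-1/2} e^{∑ (y + log |a u|) / 2}`. When `K u = 0` both sides vanish, even if `A u` is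
-- singular.
omit [MeasurableSpace Ω] in
include h in
theorem kernel_octantMap {u : Ω} (hu : K u ≠ 0 → (A u).det ≠ 0) (i : Fin (2 ^ n))
    (f : (Fin n → ℝ) → ℂ) (y : EuclideanSpace ℝ (Fin n)) :
    ((Real.exp ((∑ k, y k) / 2) : ℝ) : ℂ) * (K u * f ((A u).mulVec (octantMap C (e i) y.ofLp))) =
      ∑ j, signDensity K a e i j u * octantPullback C (e j) f (y + logAbs (a u)) := by
  by_cases hK : K u = 0
  · have h0 : ∀ j, signDensity K a e i j u = 0 := fun j =>
      Set.indicator_apply_eq_zero.2 fun _ => by rw [hK, mul_zero]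
    simp only [hK, h0, zero_mul, mul_zero, Finset.sum_const_zero]
  · have hne : ∀ k, a u k ≠ 0 := by
      have h1 := hu hK
      rw [h.det_eq, Finset.prod_ne_zero_iff] at h1
      exact fun k => h1 k (Finset.mem_univ k)
    obtain ⟨j, hj⟩ := exists_mem_signSet e i hne
    rw [Finset.sum_eq_single j]
    · rw [signDensity, Set.indicator_of_mem hj, abs_prod_rpow_neg_half hne, octantPullback,
        h.mulVec_octantMap hj]
      have h2 : Real.exp ((∑ k, y k) / 2) = Real.exp (-(∑ k, logAbs (a u) k) / 2) *
          Real.exp ((∑ k, (y + logAbs (a u)) k) / 2) := by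
        rw [← Real.exp_add]
        congr 1
        simp only [PiLp.add_apply, Finset.sum_add_distrib]
        ring
      rw [h2, Complex.ofReal_mul]
      ring
    · intro j' _ hj'
      rw [signDensity, Set.indicator_of_notMem, zero_mul]
      exact fun hmem => hj' (signSet_disjoint hmem hj)
    · simp

theorem isHausdorffOperator_hausdorffOperator [SFinite μ]
    (hdet : ∀ᵐ u ∂μ, K u ≠ 0 → (A u).det ≠ 0) :
    IsHausdorffOperator μ K A (hausdorffOperator hint ha e h) := by
  intro f hf
  -- Both claims are checked on each hyperoctant after multiplication by the nonvanishing weight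
  -- `e^{∑ y / 2}`.
  refine (ae_iff_forall_ae_octantMap h.orthogonal e).2 fun i => ?_
  have hF := (memLp_iff_octantPullback h.orthogonal e).1 hf
  have hκ := integrable_signDensity hint ha e
  have hb := aemeasurable_logAbs ha
  have hconv : ∀ᵐ y, ∀ j, Integrable (fun u => signDensity K a e i j u *
      octantPullback C (e j) f (y + logAbs (a u))) μ :=
    ae_all_iff.2 fun j => ae_integrable_mul_comp_add (hF j) (hκ i j) hb
  have hmult : ∀ᵐ y, ∀ j, fourierMultiplier (fourierSymbol (hκ i j) hb) ((hF j).toLp _) y =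
      ∫ u, signDensity K a e i j u * octantPullback C (e j) f (y + logAbs (a u)) ∂μ :=
    ae_all_iff.2 fun j => fourierMultiplier_fourierSymbol_ae_eq (hF j) (hκ i j) hb
  have hH := octantIsometry_hausdorffOperator hint ha e h (hf.toLp f) i
  simp only [octantIsometry_toLp] at hH
  have hcoe : octantIsometry h.orthogonal e (hausdorffOperator hint ha e h (hf.toLp f)) i =ᵐ[volume]
      octantPullback C (e i) (hausdorffOperator hint ha e h (hf.toLp f)) :=
    MemLp.coeFn_toLp ((memLp_iff_octantPullback h.orthogonal e).1 (Lp.memLp _) i)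
  rw [hH] at hcoe
  filter_upwards [hconv, hmult, hcoe, Lp.coeFn_finsetSum Finset.univ fun j =>
    fourierMultiplier (continuousSymbol hint ha e i j) ((hF j).toLp _)] with y h1 h2 h3 h4
  have hρ : ((Real.exp ((∑ k, y k) / 2) : ℝ) : ℂ) ≠ 0 :=
    Complex.ofReal_ne_zero.2 (Real.exp_pos _).ne'
  have hker : (fun u => ((Real.exp ((∑ k, y k) / 2) : ℝ) : ℂ) *
      (K u * f ((A u).mulVec (octantMap C (e i) y.ofLp)))) =ᵐ[μ]
      fun u => ∑ j, signDensity K a e i j u * octantPullback C (e j) f (y + logAbs (a u)) := by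
    filter_upwards [hdet] with u hu
    exact kernel_octantMap e h hu i f y
  constructor
  · exact (integrable_const_mul_iff hρ.isUnit _).1
      ((integrable_finsetSum _ fun j _ => h1 j).congr hker.symm)
  · apply mul_left_cancel₀ hρ
    rw [← integral_const_mul, integral_congr_ae hker, integral_finsetSum _ fun j _ => h1 j]
    simp_rw [← h2]
    refine h3.symm.trans (h4.trans ?_)
    rw [Finset.sum_apply]
    rfl

end HausdorffOperators

/-! ### Simultaneous orthogonal diagonalization of a commuting family. -/

section SimultaneousDiagonalization

-- The joint eigenspaces are mutually orthogonal and span, for any index set `Ω`. In finite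
-- dimension only finitely many are nonzero, so an orthonormal basis subordinate to them exists.
open Module.End in
theorem exists_orthonormalBasis_forall_eigenvector {V Ω : Type*} [NormedAddCommGroup V]
    [InnerProductSpace ℝ V] [FiniteDimensional ℝ V] {n : ℕ} (hn : Module.finrank ℝ V = n)
    {T : Ω → V →ₗ[ℝ] V} (hT : ∀ u, (T u).IsSymmetric) (hcomm : ∀ u v, Commute (T u) (T v)) :
    ∃ (b : OrthonormalBasis (Fin n) ℝ V) (a : Ω → Fin n → ℝ), ∀ u k, T u (b k) = a u k • b k := by
  classical
  have horth := LinearMap.IsSymmetric.orthogonalFamily_iInf_eigenspaces hT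
  have htop := LinearMap.IsSymmetric.iSup_iInf_eq_top_of_commute hT fun u v _ => hcomm u v
  let W : (Ω → ℝ) → Submodule ℝ V := fun χ => ⨅ u, eigenspace (T u) (χ u)
  have : Finite {χ // W χ ≠ ⊥} := WellFoundedGT.finite_ne_bot_of_iSupIndep horth.independent
  have : Fintype {χ // W χ ≠ ⊥} := Fintype.ofFinite _
  have horth' : OrthogonalFamily ℝ (fun χ : {χ // W χ ≠ ⊥} => W χ.1) fun χ => (W χ.1).subtypeₗᵢ :=
    horth.comp Subtype.coe_injective
  have hint : DirectSum.IsInternal fun χ : {χ // W χ ≠ ⊥} => W χ.1 := by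
    rw [horth'.isInternal_iff, iSup_ne_bot_subtype, htop, Submodule.top_orthogonal_eq_bot]
  refine ⟨hint.subordinateOrthonormalBasis hn horth',
    fun u k => (hint.subordinateOrthonormalBasisIndex hn k horth').1 u, fun u k => ?_⟩
  have hmem := hint.subordinateOrthonormalBasis_subordinate hn k horth'
  exact mem_eigenspace_iff.1 ((Submodule.mem_iInf _).1 hmem u)

theorem exists_isSimultaneousDiagonalization {Ω : Type*} {n : ℕ}
    {A : Ω → Matrix (Fin n) (Fin n) ℝ} (hA : ∀ u, (A u).IsHermitian)
    (hcomm : ∀ u v, Commute (A u) (A v)) : ∃ C a, IsSimultaneousDiagonalization A C a := by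
  obtain ⟨b, a, hb⟩ := exists_orthonormalBasis_forall_eigenvector (n := n)
    (V := EuclideanSpace ℝ (Fin n)) (by simp)
    (T := fun u => Matrix.toEuclideanLin (A u))
    (fun u => Matrix.isSymmetric_toEuclideanLin_iff.2 (hA u)) (fun u v => by
      rw [commute_iff_eq, Module.End.mul_eq_comp, Module.End.mul_eq_comp]
      ext1 x
      simp only [Matrix.toLpLin_apply, LinearMap.comp_apply, Matrix.mulVec_mulVec,
        (hcomm u v).eq])
  have hC : Matrix.of (fun i k => b k i) ∈ Matrix.orthogonalGroup (Fin n) ℝ := by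
    rw [Matrix.mem_unitaryGroup_iff']
    ext k l
    have h1 := orthonormal_iff_ite.1 b.orthonormal l k
    simp only [PiLp.inner_apply, RCLike.inner_apply, conj_trivial] at h1
    simp only [Matrix.star_eq_conjTranspose, Matrix.mul_apply, Matrix.conjTranspose_apply,
      Matrix.of_apply, star_trivial, h1, Matrix.one_apply, eq_comm (a := k)]
  refine ⟨Matrix.of (fun i k => b k i), a, hC, fun u => ?_⟩
  have h2 : A u * Matrix.of (fun i k => b k i) =
      Matrix.of (fun i k => b k i) * Matrix.diagonal (a u) := by
    ext i k
    have h3 := congrArg (fun x => x i) (hb u k)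
    simp only [Matrix.toLpLin_apply, PiLp.smul_apply, smul_eq_mul] at h3
    rw [Matrix.mul_diagonal, Matrix.of_apply, mul_comm, ← h3]
    rfl
  rw [mul_assoc, h2, ← mul_assoc,
    Matrix.inv_eq_left_inv (Matrix.mem_unitaryGroup_iff'.1 hC),
    Matrix.mem_unitaryGroup_iff'.1 hC, one_mul]

end SimultaneousDiagonalization

/-! ### Invariance of operator properties under unitary conjugation. -/

section Conjugation

variable {V W : Type*} [NormedAddCommGroup V] [InnerProductSpace ℂ V] [CompleteSpace V]
  [NormedAddCommGroup W] [InnerProductSpace ℂ W] [CompleteSpace W]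

namespace LinearIsometryEquiv

theorem isSelfAdjoint_conjStarAlgEquiv_iff (U : V ≃ₗᵢ[ℂ] W) {T : V →L[ℂ] V} :
    IsSelfAdjoint (U.conjStarAlgEquiv T) ↔ IsSelfAdjoint T :=
  ⟨fun h => U.conjStarAlgEquiv.injective ((map_star U.conjStarAlgEquiv T).trans h),
    fun h => h.map U.conjStarAlgEquiv⟩

theorem isPositive_conjStarAlgEquiv_iff (U : V ≃ₗᵢ[ℂ] W) {T : V →L[ℂ] V} :
    (U.conjStarAlgEquiv T).IsPositive ↔ T.IsPositive := by
  rw [ContinuousLinearMap.isPositive_iff', ContinuousLinearMap.isPositive_iff',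
    U.isSelfAdjoint_conjStarAlgEquiv_iff]
  refine and_congr_right' ⟨fun h x => ?_, fun h y => ?_⟩
  · simpa using h (U x)
  · have h1 := h (U.symm y)
    rw [← U.inner_map_map] at h1
    simpa using h1

theorem conjStarAlgEquiv_mem_unitary_iff (U : V ≃ₗᵢ[ℂ] W) {T : V →L[ℂ] V} :
    U.conjStarAlgEquiv T ∈ unitary (W →L[ℂ] W) ↔ T ∈ unitary (V →L[ℂ] V) := by
  simp only [Unitary.mem_iff, ← map_star, ← map_mul,
    map_eq_one_iff U.conjStarAlgEquiv U.conjStarAlgEquiv.injective]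

end LinearIsometryEquiv

end Conjugation

/-! ### The main theorem. -/

theorem corollary5 {Ω : Type*} [TopologicalSpace Ω] [SigmaCompactSpace Ω] [MeasurableSpace Ω]
    [BorelSpace Ω] (μ : Measure Ω) [μ.Regular] (n : ℕ)
    (K : Ω → ℂ) (hK : LocallyIntegrable K μ)
    (A : Ω → Matrix (Fin n) (Fin n) ℝ)
    (hAmeas : ∀ i j, AEMeasurable (fun u => A u i j) μ)
    (hAsing : ∀ᵐ u ∂μ, K u ≠ 0 → IsUnit (A u).det)
    (hAsa : ∀ u, (A u).IsHermitian)
    (hAcomm : ∀ u v, Commute (A u) (A v))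
    (hint : Integrable (fun u => ((|(A u).det| ^ (-(1 / 2) : ℝ) : ℝ) : ℂ) * K u) μ) :
    (∃ C a, IsSimultaneousDiagonalization A C a) ∧
    ∃ H : L2Space n →L[ℂ] L2Space n, IsHausdorffOperator μ K A H ∧
      ∀ (C : Matrix (Fin n) (Fin n) ℝ) (a : Ω → Fin n → ℝ),
        IsSimultaneousDiagonalization A C a →
        ∀ e : Fin (2 ^ n) ≃ (Fin n → ℤˣ),
          (IsSelfAdjoint H ↔ ∀ s : Fin n → ℝ, (matrixSymbol μ K a e s).IsHermitian) ∧
          (H.IsPositive ↔ ∀ s : Fin n → ℝ, (matrixSymbol μ K a e s).PosSemidef) ∧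
          (H ∈ unitary (L2Space n →L[ℂ] L2Space n) ↔
            ∀ s : Fin n → ℝ,
              matrixSymbol μ K a e s ∈ Matrix.unitaryGroup (Fin (2 ^ n)) ℂ) := by
  have hdet : ∀ᵐ u ∂μ, K u ≠ 0 → (A u).det ≠ 0 :=
    hAsing.mono fun u hu hKu => (hu hKu).ne_zero
  have hint' : ∀ {C : Matrix (Fin n) (Fin n) ℝ} {a : Ω → Fin n → ℝ},
      IsSimultaneousDiagonalization A C a →
      Integrable (fun u => ((|∏ k, a u k| ^ (-(1 / 2) : ℝ) : ℝ) : ℂ) * K u) μ := fun h => by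
    simpa only [h.det_eq] using hint
  have hmain : ∀ {C : Matrix (Fin n) (Fin n) ℝ} {a : Ω → Fin n → ℝ}
      (h : IsSimultaneousDiagonalization A C a) (e : Fin (2 ^ n) ≃ (Fin n → ℤˣ)),
      IsHausdorffOperator μ K A (hausdorffOperator (hint' h) (h.aemeasurable hAmeas) e h) :=
    -- A regular measure on a σ-compact space is σ-finite, which supplies the Fubini hypothesis.
    fun h e => isHausdorffOperator_hausdorffOperator _ _ e h hdet
  have hex := exists_isSimultaneousDiagonalization hAsa hAcomm
  refine ⟨hex, ?_⟩
  obtain ⟨C₀, a₀, h₀⟩ := hex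
  have e₀ : Fin (2 ^ n) ≃ (Fin n → ℤˣ) := (Fintype.equivFinOfCardEq (by simp)).symm
  refine ⟨_, hmain h₀ e₀, fun C a h e => ?_⟩
  -- The operator was built from one choice of `C`, `a`, `e`; uniqueness identifies it with the one
  -- built from any other choice.
  rw [(hmain h₀ e₀).unique (hmain h e), hausdorffOperator]
  refine ⟨?_, ?_, ?_⟩
  · rw [LinearIsometryEquiv.isSelfAdjoint_conjStarAlgEquiv_iff, isSelfAdjoint_matMulLp_iff]
    exact forall_continuousSymbol_map_iff _ _ e (p := Matrix.IsHermitian)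
  · rw [LinearIsometryEquiv.isPositive_conjStarAlgEquiv_iff, matMulLp_isPositive_iff]
    exact forall_continuousSymbol_map_iff _ _ e (p := Matrix.PosSemidef)
  · rw [LinearIsometryEquiv.conjStarAlgEquiv_mem_unitary_iff, matMulLp_mem_unitary_iff]
    exact forall_continuousSymbol_map_iff _ _ e (p := fun M => M ∈ Matrix.unitaryGroup _ ℂ)
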